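/- Let $\alpha=(\alpha_{\mathbf k})$ and $\beta=(\beta_{\mathbf k})$, $\mathbf k\in\mathbb Z_+^2$, be bounded families of positive real numbers, and let $W_{(\alpha,\beta)}=(T_1,T_2)$ be the $2$-variable weighted shift on $\ell^2(\mathbb Z_+^2)$ given by $T_1e_{\mathbf k}=\alpha_{\mathbf k}e_{\mathbf k+(1,0)}$ and $T_2e_{\mathbf k}=\beta_{\mathbf k}e_{\mathbf k+(0,1)}$, where $\{e_{\mathbf k}\}$ is the canonical orthonormal basis. For a pair $(T_1,T_2)$ of bounded operators on a complex Hilbert space put $P:=(T_1^*T_1+T_2^*T_2)^{1/2}$, and let $V_1,V_2$ be the bounded operators with $T_i=V_iP$ that vanish on $\ker P$. The spherical Aluthge transform of $(T_1,T_2)$ is $(\sqrt P\,V_1\sqrt P,\ \sqrt P\,V_2\sqrt P)$. The pair is called spherically quasinormal if $T_1T_2=T_2T_1$ and $(T_1,T_2)$ equals its spherical Aluthge transform; a spherical isometry if $T_1T_2=T_2T_1$ and $T_1^*T_1+T_2^*T_2=I$; and subnormal if it is the restriction of a commuting pair of normal operators, on a larger Hilbert space, to a common invariant subspace. Then: 1.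 $W_{(\alpha,\beta)}$ is spherically quasinormal if and only if there is $C>0$ such that $\frac1C W_{(\alpha,\beta)}=(\frac1C T_1,\frac1C T_2)$ is a spherical isometry. 2. $W_{(\alpha,\beta)}$ is spherically quasinormal if and only if $T_1T_2=T_2T_1$ and $\alpha_{\mathbf k}^2+\beta_{\mathbf k}^2$ does not depend on $\mathbf k\in\mathbb Z_+^2$. 3. If $W_{(\alpha,\beta)}$ is spherically quasinormal, then it is subnormal. -/

import Mathlib

open scoped ENNReal InnerProductSpace

noncomputable section

namespace SphericalAluthge

/-! ### Pairs of operators on a complex Hilbert space -/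

section Operators

variable {H : Type*} [NormedAddCommGroup H] [InnerProductSpace ℂ H] [CompleteSpace H]

/-- The positive factor `P = (T₁* T₁ + T₂* T₂)^{1/2}` of the joint polar decomposition. -/
def jointAbs (T₁ T₂ : H →L[ℂ] H) : H →L[ℂ] H :=
  CFC.sqrt (star T₁ * T₁ + star T₂ * T₂)

theorem jointAbs_nonneg (T₁ T₂ : H →L[ℂ] H) : 0 ≤ jointAbs T₁ T₂ :=
  CFC.sqrt_nonneg _

theorem jointAbs_mul_self (T₁ T₂ : H →L[ℂ] H) :
    jointAbs T₁ T₂ * jointAbs T₁ T₂ = star T₁ * T₁ + star T₂ * T₂ :=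
  CFC.sqrt_mul_sqrt_self _ (add_nonneg (star_mul_self_nonneg T₁) (star_mul_self_nonneg T₂))

theorem norm_jointAbs_apply_sq (T₁ T₂ : H →L[ℂ] H) (x : H) :
    ‖jointAbs T₁ T₂ x‖ ^ 2 = ‖T₁ x‖ ^ 2 + ‖T₂ x‖ ^ 2 := by
  have key : ∀ A : H →L[ℂ] H, ‖A x‖ ^ 2 = RCLike.re ⟪(star A * A) x, x⟫_ℂ := fun A => by
    rw [ContinuousLinearMap.star_eq_adjoint]
    exact A.apply_norm_sq_eq_inner_adjoint_left x
  have hsa : star (jointAbs T₁ T₂) = jointAbs T₁ T₂ :=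
    (IsSelfAdjoint.of_nonneg (jointAbs_nonneg T₁ T₂)).star_eq
  rw [key, key, key, hsa, jointAbs_mul_self, add_apply, inner_add_left, map_add]

/-- The closure of the range of `P`. -/
def closedRange (P : H →L[ℂ] H) : Submodule ℂ H :=
  (LinearMap.range (P : H →ₗ[ℂ] H)).topologicalClosure

instance (P : H →L[ℂ] H) : CompleteSpace (closedRange P) :=
  (Submodule.isClosed_topologicalClosure _).completeSpace_coe

/-- `P`, as a map into the closure of its range. -/
def toClosedRange (P : H →L[ℂ] H) : H →ₗ[ℂ] closedRange P :=
  (P : H →ₗ[ℂ] H).codRestrict (closedRange P)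
    fun x => Submodule.le_topologicalClosure _ ⟨x, rfl⟩

theorem denseRange_toClosedRange (P : H →L[ℂ] H) : DenseRange (toClosedRange P) := by
  intro y
  rw [closure_subtype]
  have h : ((↑) '' Set.range (toClosedRange P) : Set H)
      = (LinearMap.range (P : H →ₗ[ℂ] H) : Set H) := by
    ext z
    constructor
    · rintro ⟨_, ⟨x, rfl⟩, rfl⟩
      exact ⟨x, rfl⟩
    · rintro ⟨x, rfl⟩
      exact ⟨_, ⟨x, rfl⟩, rfl⟩
  rw [h]
  exact y.2

/-- The quotient `V` of `T` by `P`, for operators with `‖T x‖ ≤ c ‖P x‖`: the operator which sends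
`P x` to `T x`, is extended continuously to the closure of the range of `P`, and vanishes on the
orthogonal complement of that range. -/
def polarFactor (P T : H →L[ℂ] H) : H →L[ℂ] H :=
  ((T : H →ₗ[ℂ] H).extendOfNorm (toClosedRange P)) ∘L (closedRange P).orthogonalProjectionOnto

/-- The factors `V₁, V₂` of the joint polar decomposition `(T₁, T₂) = (V₁ P, V₂ P)`. -/
def polarFactor₁ (T₁ T₂ : H →L[ℂ] H) : H →L[ℂ] H := polarFactor (jointAbs T₁ T₂) T₁

/-- See `polarFactor₁`. -/
def polarFactor₂ (T₁ T₂ : H →L[ℂ] H) : H →L[ℂ] H := polarFactor (jointAbs T₁ T₂) T₂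

theorem polarFactor_mul (P T : H →L[ℂ] H) (h : ∀ x, ‖T x‖ ≤ ‖P x‖) :
    polarFactor P T * P = T := by
  ext x
  have hx : (closedRange P).orthogonalProjectionOnto (P x) = toClosedRange P x :=
    (closedRange P).orthogonalProjectionOnto_mem_subspace_eq_self (toClosedRange P x)
  change (T : H →ₗ[ℂ] H).extendOfNorm (toClosedRange P)
    ((closedRange P).orthogonalProjectionOnto (P x)) = T x
  rw [hx]
  exact LinearMap.extendOfNorm_eq (denseRange_toClosedRange P)
    ⟨1, fun y => by rw [one_mul]; exact h y⟩ x

/-- The joint polar decomposition: `T₁ = V₁ P` and `T₂ = V₂ P`. -/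
theorem polarFactor₁_mul_jointAbs (T₁ T₂ : H →L[ℂ] H) :
    polarFactor₁ T₁ T₂ * jointAbs T₁ T₂ = T₁ :=
  polarFactor_mul _ _ fun x => by
    have := norm_jointAbs_apply_sq T₁ T₂ x
    exact (sq_le_sq₀ (norm_nonneg _) (norm_nonneg _)).1 (by nlinarith [sq_nonneg ‖T₂ x‖])

theorem polarFactor₂_mul_jointAbs (T₁ T₂ : H →L[ℂ] H) :
    polarFactor₂ T₁ T₂ * jointAbs T₁ T₂ = T₂ :=
  polarFactor_mul _ _ fun x => by
    have := norm_jointAbs_apply_sq T₁ T₂ x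
    exact (sq_le_sq₀ (norm_nonneg _) (norm_nonneg _)).1 (by nlinarith [sq_nonneg ‖T₁ x‖])

/-- The spherical Aluthge transform `(√P V₁ √P, √P V₂ √P)` of the pair `(T₁, T₂)`. -/
def sphericalAluthge (T₁ T₂ : H →L[ℂ] H) : (H →L[ℂ] H) × (H →L[ℂ] H) :=
  (CFC.sqrt (jointAbs T₁ T₂) * polarFactor₁ T₁ T₂ * CFC.sqrt (jointAbs T₁ T₂),
   CFC.sqrt (jointAbs T₁ T₂) * polarFactor₂ T₁ T₂ * CFC.sqrt (jointAbs T₁ T₂))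

/-- A commuting pair is spherically quasinormal if it is a fixed point of the spherical Aluthge
transform. -/
def IsSphericallyQuasinormal (T₁ T₂ : H →L[ℂ] H) : Prop :=
  Commute T₁ T₂ ∧ sphericalAluthge T₁ T₂ = (T₁, T₂)

/-- A commuting pair is a spherical isometry if `T₁* T₁ + T₂* T₂ = I`. -/
def IsSphericalIsometry (T₁ T₂ : H →L[ℂ] H) : Prop :=
  Commute T₁ T₂ ∧ star T₁ * T₁ + star T₂ * T₂ = 1

end Operators

/-- A pair `(T₁, T₂)` of operators on `H` is (jointly) subnormal if it is the restriction to a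
common invariant subspace of a commuting pair `(N₁, N₂)` of normal operators on a Hilbert space
`K`; the inclusion of `H` in `K` is the isometry `J`. -/
def IsSubnormalPair.{u} {H : Type u} [NormedAddCommGroup H] [InnerProductSpace ℂ H]
    (T₁ T₂ : H →L[ℂ] H) : Prop :=
  ∃ (K : Type u) (_ : NormedAddCommGroup K) (_ : InnerProductSpace ℂ K) (_ : CompleteSpace K)
    (J : H →ₗᵢ[ℂ] K) (N₁ N₂ : K →L[ℂ] K),
    IsStarNormal N₁ ∧ IsStarNormal N₂ ∧ Commute N₁ N₂ ∧
      ∀ x, N₁ (J x) = J (T₁ x) ∧ N₂ (J x) = J (T₂ x)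

/-! ### Weighted shifts in two variables -/

/-- The Hilbert space of square-summable complex families indexed by `ℕ × ℕ`. -/
abbrev L2 : Type := lp (fun _ : ℕ × ℕ => ℂ) 2

/-- Bounded real families indexed by `ℕ × ℕ`. -/
abbrev Weights : Type := lp (fun _ : ℕ × ℕ => ℝ) ∞

/-- The canonical orthonormal basis of `L2`. -/
def e (k : ℕ × ℕ) : L2 := lp.single 2 k 1

/-- The coordinates of the image of `f` under the shift by `ε` with weights `w`. -/
def shiftFun (ε : ℕ × ℕ) (w : Weights) (f : L2) (k : ℕ × ℕ) : ℂ :=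
  if ε ≤ k then (w (k - ε) : ℂ) * f (k - ε) else 0

theorem shiftFun_add (ε : ℕ × ℕ) (w : Weights) (f : L2) (k : ℕ × ℕ) :
    shiftFun ε w f (k + ε) = (w k : ℂ) * f k := by
  simp [shiftFun]

theorem shiftFun_of_notMem_range (ε : ℕ × ℕ) (w : Weights) (f : L2) (k : ℕ × ℕ)
    (hk : k ∉ Set.range (· + ε)) : shiftFun ε w f k = 0 := by
  rw [shiftFun, if_neg]
  exact fun h => hk ⟨k - ε, tsub_add_cancel_of_le h⟩

theorem norm_shiftFun_add_sq_le (ε : ℕ × ℕ) (w : Weights) (f : L2) (k : ℕ × ℕ) :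
    ‖shiftFun ε w f (k + ε)‖ ^ 2 ≤ ‖w‖ ^ 2 * ‖f k‖ ^ 2 := by
  rw [shiftFun_add, norm_mul, mul_pow, Complex.norm_real]
  gcongr
  exact lp.norm_apply_le_norm ENNReal.top_ne_zero w k

theorem summable_norm_sq (f : L2) : Summable fun k => ‖f k‖ ^ 2 := by
  have := (lp.memℓp f).summable (by norm_num)
  simpa using this

theorem summable_shiftFun_add (ε : ℕ × ℕ) (w : Weights) (f : L2) :
    Summable fun k => ‖shiftFun ε w f (k + ε)‖ ^ 2 :=
  Summable.of_nonneg_of_le (fun _ => by positivity) (norm_shiftFun_add_sq_le ε w f)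
    ((summable_norm_sq f).mul_left _)

theorem memℓp_shiftFun (ε : ℕ × ℕ) (w : Weights) (f : L2) : Memℓp (shiftFun ε w f) 2 := by
  have h : Summable fun k => ‖shiftFun ε w f k‖ ^ 2 := by
    refine ((add_left_injective ε).summable_iff ?_).1 (summable_shiftFun_add ε w f)
    intro k hk
    simp [shiftFun_of_notMem_range ε w f k hk]
  refine memℓp_gen ?_
  simpa using h

/-- The bounded operator on `L2` with `e k ↦ w k • e (k + ε)`. -/
def shift (ε : ℕ × ℕ) (w : Weights) : L2 →L[ℂ] L2 :=
  LinearMap.mkContinuous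
    { toFun := fun f => ⟨shiftFun ε w f, memℓp_shiftFun ε w f⟩
      map_add' := fun f g => by
        ext k
        change shiftFun ε w (f + g) k = shiftFun ε w f k + shiftFun ε w g k
        simp only [shiftFun, lp.coeFn_add, Pi.add_apply]
        split_ifs <;> ring
      map_smul' := fun c f => by
        ext k
        change shiftFun ε w (c • f) k = c * shiftFun ε w f k
        simp only [shiftFun, lp.coeFn_smul, Pi.smul_apply, smul_eq_mul]
        split_ifs <;> ring }
    ‖w‖ fun f => by
      have hsq : ∀ g : L2, ‖g‖ ^ 2 = ∑' k, ‖g k‖ ^ 2 := fun g => by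
        have := lp.norm_rpow_eq_tsum (p := 2) (by norm_num) g
        simpa using this
      refine (sq_le_sq₀ (norm_nonneg _) (by positivity)).1 ?_
      rw [mul_pow, hsq, hsq f, ← tsum_mul_left]
      change ∑' k, ‖shiftFun ε w f k‖ ^ 2 ≤ _
      rw [← (add_left_injective ε).tsum_eq (f := fun k => ‖shiftFun ε w f k‖ ^ 2)]
      · exact Summable.tsum_le_tsum (norm_shiftFun_add_sq_le ε w f) (summable_shiftFun_add ε w f)
          ((summable_norm_sq f).mul_left _)
      · intro k hk
        by_contra h
        exact hk (by simp [shiftFun_of_notMem_range ε w f k h])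

theorem shift_apply_e (ε : ℕ × ℕ) (w : Weights) (k : ℕ × ℕ) :
    shift ε w (e k) = (w k : ℂ) • e (k + ε) := by
  ext j
  change shiftFun ε w (e k) j = (w k : ℂ) * e (k + ε) j
  by_cases hj : j ∈ Set.range (· + ε)
  · obtain ⟨i, rfl⟩ := hj
    rw [shiftFun_add]
    by_cases hik : i = k
    · subst hik; simp [e]
    · simp [e, hik]
  · rw [shiftFun_of_notMem_range _ _ _ _ hj]
    have : j ≠ k + ε := fun h => hj ⟨k, h.symm⟩
    simp [e, this]

/-- The first component `T₁ e_k = α_k e_{k + (1,0)}` of the shift with weights `(α, β)`. -/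
def shift₁ (α : Weights) : L2 →L[ℂ] L2 := shift (1, 0) α

/-- The second component `T₂ e_k = β_k e_{k + (0,1)}` of the shift with weights `(α, β)`. -/
def shift₂ (β : Weights) : L2 →L[ℂ] L2 := shift (0, 1) β

end SphericalAluthge

end

/-!
For a weighted shift with positive weights, `T₁* T₁ + T₂* T₂` is diagonal with entries
`α k ^ 2 + β k ^ 2`, so the positive factor `P` and its square root are diagonal too. Comparing the
coefficients of `e (k + ε)` in `√P V √P (e k) = T (e k)` (`eigenvalue_eq_of_fixed`) shows that a
fixed point of the spherical Aluthge transform has the same entry at `k` and at `k + ε`, so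
`α ^ 2 + β ^ 2` is constant. If conversely `T₁* T₁ + T₂* T₂ = c`, then `P` and `√P` are scalars and
cancel out of the transform (`isSphericallyQuasinormal_of_gram_eq_smul_one`). The condition on the
spherical isometry is the same one with `c = C ^ 2`.

For subnormality, let `g` be the product of the weights along a lattice path from the origin,
divided by `c ^ (|k| / 2)`; commutativity makes it independent of the path. Then `γ = g ^ 2`
satisfies `γ (i, j) = γ (i + 1, j) + γ (i, j + 1)`, so that the `γ (i, j)` are the iterated
differences of a completely monotone sequence, hence the moments of a measure on the segment
`s + t = 1`, as in Hausdorff's moment problem. Rotating this measure by the torus gives a measure on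
the unit sphere of `ℂ²` for which the monomials `z ^ k` are orthogonal with squared norms `γ k`, and
multiplication by the coordinates, rescaled by `√c`, extends the shift.

No measure is needed, only the positive functional on continuous functions. It is obtained as a
limit along an ultrafilter of finite sums over a grid: Bernstein weights on the segment
(`tendsto_bernsteinMoment`) and roots of unity on the torus (`sum_star_pow_mul_pow_eq`). The
Gelfand–Naimark–Segal construction turns it into a Hilbert space with a commuting pair of normal
operators (`exists_commuting_normal_pair_inner_eq`).
-/

open scoped ENNReal InnerProductSpace

noncomputable section

namespace SphericalAluthge

/-! ### Fixed points of the spherical Aluthge transform -/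

section Operators

variable {H : Type*} [NormedAddCommGroup H] [InnerProductSpace ℂ H] [CompleteSpace H]

/-- The square root of a positive operator acts on an eigenvector by the square root of the
eigenvalue. -/
theorem sqrt_apply_of_apply_eq_smul {A : H →L[ℂ] H} (hA : 0 ≤ A) {x : H} {s : ℝ} (hs : 0 < s)
    (hx : A x = ((s ^ 2 : ℝ) : ℂ) • x) : CFC.sqrt A x = (s : ℂ) • x := by
  set B := CFC.sqrt A with hB
  have hBB : B (B x) = A x := by
    rw [← mul_apply_eq_comp, hB, CFC.sqrt_mul_sqrt_self A hA]
  have hBpos : B.IsPositive := (ContinuousLinearMap.nonneg_iff_isPositive B).1 (CFC.sqrt_nonneg A)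
  -- `(B + s) y = 0` for `y = (B - s) x`, which forces `y = 0` since `B` is positive and `s > 0`.
  set y := B x - (s : ℂ) • x with hy
  have hBy : B y = (-s : ℂ) • y := by
    rw [hy, map_sub, map_smul, hBB, hx]
    push_cast
    module
  have h0 := hBpos.re_inner_nonneg_left y
  rw [hBy, inner_smul_left, inner_self_eq_norm_sq_to_K] at h0
  have h1 : RCLike.re ((starRingEnd ℂ) (-s : ℂ) * ((‖y‖ : ℂ)) ^ 2) = - s * ‖y‖ ^ 2 := by
    rw [map_neg, Complex.conj_ofReal]
    norm_cast
  have h2 : 0 ≤ - s * ‖y‖ ^ 2 := h1 ▸ h0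
  have h3 : ‖y‖ ^ 2 ≤ 0 := by nlinarith [sq_nonneg ‖y‖]
  have h4 : y = 0 := by
    have : ‖y‖ ^ 2 = 0 := le_antisymm h3 (sq_nonneg _)
    simpa using this
  exact sub_eq_zero.1 h4

/-- If `T = V P` maps an eigenvector `x` of `P` to a nonzero multiple of an eigenvector `y`, and
`√P V √P = T`, then the eigenvalues `s ^ 2` of `x` and `t ^ 2` of `y` agree: `√P V √P` maps `x` to
`t / s` times `T x`. -/
theorem eigenvalue_eq_of_fixed {P V T : H →L[ℂ] H} (hP : 0 ≤ P) (hV : V * P = T) {x y : H}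
    {s t w : ℝ} (hy : y ≠ 0) (hs : 0 < s) (ht : 0 < t) (hw : w ≠ 0)
    (hPx : P x = ((s ^ 2 : ℝ) : ℂ) • x) (hPy : P y = ((t ^ 2 : ℝ) : ℂ) • y)
    (hT : T x = (w : ℂ) • y) (hfix : CFC.sqrt P * V * CFC.sqrt P = T) : s = t := by
  have hVx : ((s ^ 2 : ℝ) : ℂ) • V x = (w : ℂ) • y := by
    rw [← map_smul, ← hPx, ← hT, ← hV, mul_apply_eq_comp]
  have h1 : (w : ℂ) • y = (s : ℂ) • CFC.sqrt P (V x) := by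
    rw [← hT, ← hfix, mul_apply_eq_comp, mul_apply_eq_comp,
      sqrt_apply_of_apply_eq_smul hP hs hPx, map_smul, map_smul]
  have h2 : ((s * w : ℝ) : ℂ) • y = ((w * t : ℝ) : ℂ) • y := by
    have : ((s * w : ℝ) : ℂ) • y = CFC.sqrt P (((s ^ 2 : ℝ) : ℂ) • V x) := by
      rw [map_smul, Complex.ofReal_mul, mul_smul, h1, smul_smul]
      push_cast; rw [sq]
    rw [this, hVx, map_smul, sqrt_apply_of_apply_eq_smul hP ht hPy, smul_smul]
    push_cast; rfl
  have h3 : s * w = w * t := by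
    exact_mod_cast smul_left_injective ℂ hy h2
  exact mul_left_cancel₀ hw (by linarith)

theorem jointAbs_apply_of_gram_apply {T₁ T₂ : H →L[ℂ] H} {x : H} {c : ℝ} (hc0 : 0 < c)
    (hc : (star T₁ * T₁ + star T₂ * T₂) x = (c : ℂ) • x) : jointAbs T₁ T₂ x = (√c : ℂ) • x := by
  refine sqrt_apply_of_apply_eq_smul
    (add_nonneg (star_mul_self_nonneg _) (star_mul_self_nonneg _)) (by positivity) ?_
  rw [hc, Real.sq_sqrt hc0.le]

/-- A commuting pair which is a positive multiple of a spherical isometry is spherically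
quasinormal: `P` is a scalar, so `√P V √P = V P`. -/
theorem isSphericallyQuasinormal_of_gram_eq_smul_one {T₁ T₂ : H →L[ℂ] H} (hcomm : Commute T₁ T₂)
    {c : ℝ} (hc0 : 0 < c) (hc : star T₁ * T₁ + star T₂ * T₂ = (c : ℂ) • 1) :
    IsSphericallyQuasinormal T₁ T₂ := by
  have hP : jointAbs T₁ T₂ = (√c : ℂ) • 1 := by
    ext x
    exact jointAbs_apply_of_gram_apply hc0 (by rw [hc]; rfl)
  have hS : CFC.sqrt (jointAbs T₁ T₂) = (√√c : ℂ) • 1 := by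
    ext x
    refine sqrt_apply_of_apply_eq_smul (jointAbs_nonneg _ _) (by positivity) ?_
    rw [hP, Real.sq_sqrt (by positivity)]; rfl
  have key : ∀ V T : H →L[ℂ] H, V * jointAbs T₁ T₂ = T →
      CFC.sqrt (jointAbs T₁ T₂) * V * CFC.sqrt (jointAbs T₁ T₂) = T := fun V T hVT => by
    rw [← hVT, hS, hP, smul_mul_assoc, smul_mul_assoc, mul_smul_comm, mul_smul_comm, smul_smul,
      one_mul]
    norm_cast
    rw [Real.mul_self_sqrt (Real.sqrt_nonneg c)]
  exact ⟨hcomm, Prod.ext (key _ _ (polarFactor₁_mul_jointAbs _ _))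
    (key _ _ (polarFactor₂_mul_jointAbs _ _))⟩

end Operators

/-! ### Weighted shifts with constant `α ^ 2 + β ^ 2` -/

theorem inner_e_left (k : ℕ × ℕ) (f : L2) : ⟪e k, f⟫_ℂ = f k := by
  rw [e, lp.inner_single_left]; simp

theorem e_apply (k j : ℕ × ℕ) : e k j = if j = k then 1 else 0 := by
  by_cases h : j = k
  · subst h; simp [e]
  · simp [e, h]

theorem e_ne_zero (k : ℕ × ℕ) : e k ≠ 0 := fun h => by
  have := e_apply k k
  simp [h] at this

/-- Bounded operators on `L2` which agree on the canonical basis are equal. -/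
theorem ext_e {F : Type*} [NormedAddCommGroup F] [NormedSpace ℂ F] {A B : L2 →L[ℂ] F}
    (h : ∀ k, A (e k) = B (e k)) : A = B := by
  refine lp.ext_continuousLinearMap (p := 2) (by norm_num) fun k => ?_
  ext
  exact h k

theorem star_mul_self_shift_apply_e (ε : ℕ × ℕ) (w : Weights) (k : ℕ × ℕ) :
    (star (shift ε w) * shift ε w) (e k) = ((w k ^ 2 : ℝ) : ℂ) • e k := by
  ext j
  rw [← inner_e_left, ContinuousLinearMap.star_eq_adjoint, mul_apply_eq_comp,
    ContinuousLinearMap.adjoint_inner_right, shift_apply_e, shift_apply_e, inner_smul_left,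
    inner_smul_right, inner_e_left, e_apply, lp.coeFn_smul, Pi.smul_apply, e_apply]
  by_cases h : j = k
  · subst h; simp [sq]
  · simp [h]

theorem gram_apply_e (α β : Weights) (k : ℕ × ℕ) :
    (star (shift₁ α) * shift₁ α + star (shift₂ β) * shift₂ β) (e k) =
      ((α k ^ 2 + β k ^ 2 : ℝ) : ℂ) • e k := by
  rw [add_apply, shift₁, shift₂, star_mul_self_shift_apply_e, star_mul_self_shift_apply_e,
    ← add_smul]
  push_cast; rfl

theorem jointAbs_apply_e {α β : Weights} {k : ℕ × ℕ} (hα : 0 < α k) :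
    jointAbs (shift₁ α) (shift₂ β) (e k) = (√(α k ^ 2 + β k ^ 2) : ℂ) • e k :=
  jointAbs_apply_of_gram_apply (by positivity) (gram_apply_e α β k)

theorem weights_sq_add_const_of_isSphericallyQuasinormal {α β : Weights} (hα : ∀ k, 0 < α k)
    (hβ : ∀ k, 0 < β k) (h : IsSphericallyQuasinormal (shift₁ α) (shift₂ β)) (k : ℕ × ℕ) :
    α k ^ 2 + β k ^ 2 = α 0 ^ 2 + β 0 ^ 2 := by
  have hp : ∀ k, 0 < α k ^ 2 + β k ^ 2 := fun k => by have := hα k; positivity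
  have hs : ∀ k, 0 < √√(α k ^ 2 + β k ^ 2) := fun k => by have := hp k; positivity
  have heig : ∀ k, jointAbs (shift₁ α) (shift₂ β) (e k) =
      (((√√(α k ^ 2 + β k ^ 2)) ^ 2 : ℝ) : ℂ) • e k := fun k => by
    rw [jointAbs_apply_e (hα k), Real.sq_sqrt (by positivity)]
  have hinj : ∀ k l, √√(α k ^ 2 + β k ^ 2) = √√(α l ^ 2 + β l ^ 2) →
      α k ^ 2 + β k ^ 2 = α l ^ 2 + β l ^ 2 := fun k l hkl => by
    rwa [Real.sqrt_inj (by positivity) (by positivity), Real.sqrt_inj (hp k).le (hp l).le] at hkl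
  have step₁ : ∀ k, α k ^ 2 + β k ^ 2 = α (k + (1, 0)) ^ 2 + β (k + (1, 0)) ^ 2 := fun k =>
    hinj _ _ (eigenvalue_eq_of_fixed (jointAbs_nonneg _ _) (polarFactor₁_mul_jointAbs _ _)
      (e_ne_zero _) (hs _) (hs _) (hα k).ne' (heig _) (heig _) (shift_apply_e _ _ _)
      (congrArg Prod.fst h.2))
  have step₂ : ∀ k, α k ^ 2 + β k ^ 2 = α (k + (0, 1)) ^ 2 + β (k + (0, 1)) ^ 2 := fun k =>
    hinj _ _ (eigenvalue_eq_of_fixed (jointAbs_nonneg _ _) (polarFactor₂_mul_jointAbs _ _)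
      (e_ne_zero _) (hs _) (hs _) (hβ k).ne' (heig _) (heig _) (shift_apply_e _ _ _)
      (congrArg Prod.snd h.2))
  obtain ⟨a, b⟩ := k
  induction b with
  | succ b ih => exact (step₂ (a, b)).symm.trans ih
  | zero =>
    induction a with
    | zero => rfl
    | succ a ih => exact (step₁ (a, 0)).symm.trans ih

theorem isSphericallyQuasinormal_of_const {α β : Weights} (hα : ∀ k, 0 < α k)
    (hcomm : Commute (shift₁ α) (shift₂ β)) {c : ℝ} (hc : ∀ k, α k ^ 2 + β k ^ 2 = c) :
    IsSphericallyQuasinormal (shift₁ α) (shift₂ β) := by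
  have hc0 : 0 < c := by have := hα 0; rw [← hc 0]; positivity
  exact isSphericallyQuasinormal_of_gram_eq_smul_one hcomm hc0 <|
    ext_e fun k => by rw [gram_apply_e, hc]; rfl

theorem gram_smul (c : ℝ) (T₁ T₂ : L2 →L[ℂ] L2) :
    star ((c : ℂ) • T₁) * ((c : ℂ) • T₁) + star ((c : ℂ) • T₂) * ((c : ℂ) • T₂) =
      ((c ^ 2 : ℝ) : ℂ) • (star T₁ * T₁ + star T₂ * T₂) := by
  simp only [star_smul, smul_mul_assoc, mul_smul_comm, smul_smul, ← smul_add]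
  simp [sq]

theorem isSphericalIsometry_smul_iff (α β : Weights) {C : ℝ} (hC : 0 < C) :
    IsSphericalIsometry (((1 / C : ℝ) : ℂ) • shift₁ α) (((1 / C : ℝ) : ℂ) • shift₂ β) ↔
      Commute (shift₁ α) (shift₂ β) ∧ ∀ k, α k ^ 2 + β k ^ 2 = C ^ 2 := by
  have hC' : ((1 / C : ℝ) : ℂ) ≠ 0 := by exact_mod_cast (one_div_pos.2 hC).ne'
  rw [IsSphericalIsometry, gram_smul]
  refine and_congr ⟨fun h => ?_, fun h => (h.smul_left _).smul_right _⟩ ⟨fun h k => ?_, fun h => ?_⟩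
  · exact (Commute.smul_left_iff₀ hC').1 ((Commute.smul_right_iff₀ hC').1 h)
  · have h1 := congrArg (fun A : L2 →L[ℂ] L2 => A (e k)) h
    simp only [smul_apply, gram_apply_e, smul_smul, one_apply_eq_self] at h1
    have h2 : (((1 / C) ^ 2 * (α k ^ 2 + β k ^ 2) : ℝ) : ℂ) • e k = (1 : ℂ) • e k := by
      rw [one_smul, Complex.ofReal_mul]; exact h1
    have h3 : (1 / C) ^ 2 * (α k ^ 2 + β k ^ 2) = 1 := by
      exact_mod_cast smul_left_injective ℂ (e_ne_zero k) h2
    field_simp at h3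
    exact h3
  · refine ext_e fun k => ?_
    rw [smul_apply, gram_apply_e, h, smul_smul, one_apply_eq_self, ← Complex.ofReal_mul,
      show (1 / C) ^ 2 * C ^ 2 = 1 by field_simp, Complex.ofReal_one, one_smul]

/-- Commutativity of the shifts in terms of the weights: the two ways around a unit square of the
lattice have the same product. -/
theorem weights_commute {α β : Weights} (h : Commute (shift₁ α) (shift₂ β)) (k : ℕ × ℕ) :
    α (k + (0, 1)) * β k = β (k + (1, 0)) * α k := by
  have h1 := congrArg (fun A : L2 →L[ℂ] L2 => A (e k)) h.eq
  simp only [mul_apply_eq_comp, shift₁, shift₂, shift_apply_e, map_smul,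
    smul_smul] at h1
  rw [add_right_comm k (1, 0) (0, 1)] at h1
  have h2 := smul_left_injective ℂ (e_ne_zero _) h1
  have h3 : β k * α (k + (0, 1)) = α k * β (k + (1, 0)) := by exact_mod_cast h2
  linarith

/-! ### The Hausdorff moment problem on the segment `s + t = 1` -/

open Finset Filter Topology

/-- The value at `s ^ a * t ^ b` of the `n`-th Bernstein approximation of the functional with moments
`γ`, which puts the weight `n.choose i * γ (i, j)` at `(s, t) = (i / n, j / n)` for `i + j = n`. The
nodes are shifted to `((i + p) / (n + r), (j + q) / (n + r))`, as removing a factor `s` or `t` moves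
the nodes; this does not affect the limit. -/
def bernsteinMoment (γ : ℕ × ℕ → ℝ) (p q r a b n : ℕ) : ℝ :=
  ∑ x ∈ HasAntidiagonal.antidiagonal n, n.choose x.1 * γ x *
    (((x.1 + p : ℝ) / (n + r)) ^ a * ((x.2 + q : ℝ) / (n + r)) ^ b)

theorem bernsteinMoment_swap (γ : ℕ × ℕ → ℝ) (p q r a b n : ℕ) :
    bernsteinMoment γ p q r a b n = bernsteinMoment (γ ∘ Prod.swap) q p r b a n := by
  unfold bernsteinMoment
  rw [← Finset.Nat.sum_antidiagonal_swap]
  refine sum_congr rfl fun x hx => ?_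
  obtain ⟨i, j⟩ := x
  rw [HasAntidiagonal.mem_antidiagonal] at hx
  have : n.choose j = n.choose i := by
    rw [← hx]; exact (Nat.choose_symm_add).symm
  simp only [Prod.swap_prod_mk, Function.comp_apply, this]
  ring

/-- The Bernstein weights have total mass `γ (0, 0)`. -/
theorem sum_choose_mul_eq {γ : ℕ × ℕ → ℝ} (hγ : ∀ i j, γ (i, j) = γ (i + 1, j) + γ (i, j + 1))
    (n : ℕ) : ∑ x ∈ HasAntidiagonal.antidiagonal n, n.choose x.1 * γ x = γ (0, 0) := by
  induction n with
  | zero => simp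
  | succ n ih =>
    have := Finset.sum_antidiagonal_choose_succ_mul (fun i j => γ (i, j)) n
    simp only [Prod.mk.eta] at this
    rw [this, ← ih, ← sum_add_distrib]
    refine sum_congr rfl fun x hx => ?_
    have h2 : n.choose x.2 = n.choose x.1 := by
      rw [HasAntidiagonal.mem_antidiagonal] at hx
      rw [← hx]; exact (Nat.choose_symm_add).symm
    rw [h2, ← mul_add, add_comm, ← hγ]

/-- Removal of one factor `s`: as `i * (n + 1).choose i = (n + 1) * n.choose (i - 1)`, the numerator
`i` in `s = (i + p) / (n + 1 + r)` turns `γ` into its translate, and the numerator `p` contributes a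
term which tends to `0`. -/
theorem bernsteinMoment_succ (γ : ℕ × ℕ → ℝ) (p q r a b n : ℕ) :
    bernsteinMoment γ p q r (a + 1) b (n + 1) =
      (n + 1 : ℝ) / (n + 1 + r) *
        bernsteinMoment (fun x => γ (x.1 + 1, x.2)) (p + 1) q (r + 1) a b n +
      p / (n + 1 + r) * bernsteinMoment γ p q r a b (n + 1) := by
  have hsplit : bernsteinMoment γ p q r (a + 1) b (n + 1) =
      ∑ x ∈ HasAntidiagonal.antidiagonal (n + 1), (x.1 : ℝ) * ((n + 1).choose x.1 * γ x *
        (((x.1 + p : ℝ) / (n + 1 + r)) ^ a * ((x.2 + q : ℝ) / (n + 1 + r)) ^ b)) / (n + 1 + r) +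
      p / (n + 1 + r) * bernsteinMoment γ p q r a b (n + 1) := by
    unfold bernsteinMoment
    rw [mul_sum, ← sum_add_distrib]
    refine sum_congr rfl fun x _ => ?_
    push_cast
    ring
  rw [hsplit, Finset.Nat.sum_antidiagonal_succ (N := ℝ)]
  simp only [Nat.cast_zero, zero_mul, zero_div, zero_add]
  congr 1
  unfold bernsteinMoment
  rw [mul_sum]
  refine sum_congr rfl fun x _ => ?_
  have h : ((n + 1).choose (x.1 + 1) : ℝ) * (x.1 + 1) = (n + 1) * n.choose x.1 := by
    exact_mod_cast (Nat.add_one_mul_choose_eq n x.1).symm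
  have e1 : (x.1 + 1 + p : ℝ) / (n + 1 + r) = (x.1 + (p + 1)) / (n + (r + 1)) := by ring
  have e2 : (x.2 + q : ℝ) / (n + 1 + r) = (x.2 + q) / (n + (r + 1)) := by ring
  push_cast
  rw [e1, e2]
  linear_combination (γ (x.1 + 1, x.2) * (((x.1 + (p + 1) : ℝ) / (n + (r + 1))) ^ a *
    ((x.2 + q : ℝ) / (n + (r + 1))) ^ b) / (n + 1 + r)) * h

theorem tendsto_bernsteinMoment_succ {γ : ℕ × ℕ → ℝ} {p q r a b : ℕ} {l m : ℝ}
    (h₁ : Tendsto (bernsteinMoment (fun x => γ (x.1 + 1, x.2)) (p + 1) q (r + 1) a b) atTop (𝓝 l))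
    (h₂ : Tendsto (bernsteinMoment γ p q r a b) atTop (𝓝 m)) :
    Tendsto (bernsteinMoment γ p q r (a + 1) b) atTop (𝓝 l) := by
  rw [← tendsto_add_atTop_iff_nat 1]
  simp only [bernsteinMoment_succ]
  have hr : Tendsto (fun n : ℕ => (p : ℝ) / (n + 1 + r)) atTop (𝓝 0) := by
    have := (tendsto_const_div_atTop_nhds_zero_nat (p : ℝ)).comp (tendsto_add_atTop_nat (1 + r))
    refine this.congr fun n => ?_
    simp [add_assoc]
  have hr' : Tendsto (fun n : ℕ => (r : ℝ) / (n + 1 + r)) atTop (𝓝 0) := by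
    have := (tendsto_const_div_atTop_nhds_zero_nat (r : ℝ)).comp (tendsto_add_atTop_nat (1 + r))
    refine this.congr fun n => ?_
    simp [add_assoc]
  have h1 : Tendsto (fun n : ℕ => (n + 1 : ℝ) / (n + 1 + r)) atTop (𝓝 1) := by
    have := hr'.const_sub 1
    rw [sub_zero] at this
    refine this.congr fun n => ?_
    field_simp
    ring
  simpa using (h1.mul h₁).add (hr.mul (h₂.comp (tendsto_add_atTop_nat 1)))

/-- The moments of the Bernstein approximations converge to `γ`. -/
theorem tendsto_bernsteinMoment {γ : ℕ × ℕ → ℝ}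
    (hγ : ∀ i j, γ (i, j) = γ (i + 1, j) + γ (i, j + 1)) (p q r a b : ℕ) :
    Tendsto (bernsteinMoment γ p q r a b) atTop (𝓝 (γ (a, b))) := by
  induction a generalizing γ p q r with
  | zero =>
    induction b generalizing γ p q r with
    | zero =>
      refine tendsto_const_nhds.congr fun n => ?_
      simp [bernsteinMoment, sum_choose_mul_eq hγ]
    | succ b ih =>
      -- The swap of the two coordinates reduces to the removal of a factor `s`.
      have hsw : ∀ (δ : ℕ × ℕ → ℝ) (p q r b : ℕ), bernsteinMoment δ p q r 0 b =
          bernsteinMoment (δ ∘ Prod.swap) q p r b 0 := fun δ p q r b =>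
        funext fun n => bernsteinMoment_swap δ p q r 0 b n
      rw [hsw]
      refine tendsto_bernsteinMoment_succ (m := γ (0, b)) ?_ ?_
      · have := ih (γ := fun x => γ (x.1, x.2 + 1)) (fun i j => hγ i (j + 1)) p (q + 1) (r + 1)
        rwa [hsw] at this
      · have := ih hγ p q r
        rwa [hsw] at this
  | succ a ih =>
    exact tendsto_bernsteinMoment_succ
      (ih (γ := fun x => γ (x.1 + 1, x.2)) (fun i j => hγ (i + 1) j) (p + 1) q (r + 1))
      (ih hγ p q r)

/-! ### A positive functional on the unit sphere of `ℂ²` with orthogonal monomials -/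

open scoped ComplexOrder

/-- A bounded sequence of positive functionals has a positive limit functional, which has the right
value wherever the sequence converges: the pointwise limit along a free ultrafilter. -/
theorem exists_positiveLinearMap_of_tendsto {X : Type*} [TopologicalSpace X] [CompactSpace X]
    (φ : ℕ → C(X, ℂ) →ₗ[ℂ] ℂ) (hpos : ∀ n f, 0 ≤ f → 0 ≤ φ n f) (M : ℝ)
    (hbd : ∀ n f, ‖φ n f‖ ≤ M * ‖f‖) :
    ∃ Λ : C(X, ℂ) →ₚ[ℂ] ℂ, ∀ f l, Tendsto (fun n => φ n f) atTop (𝓝 l) → Λ f = l := by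
  have hlim : ∀ f, ∃ l, Tendsto (fun n => φ n f) (hyperfilter ℕ) (𝓝 l) := fun f => by
    obtain ⟨l, -, hl⟩ := (isCompact_closedBall (0 : ℂ) (M * ‖f‖)).ultrafilter_le_nhds
      ((hyperfilter ℕ).map fun n => φ n f) (by
        simp only [le_principal_iff, Ultrafilter.mem_coe, Ultrafilter.mem_map]
        exact univ_mem' fun n => by simpa using hbd n f)
    exact ⟨l, hl⟩
  choose L hL using hlim
  refine ⟨.mk₀
    { toFun := L
      map_add' := fun f g => tendsto_nhds_unique (hL (f + g))
        (((hL f).add (hL g)).congr fun n => (map_add (φ n) f g).symm)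
      map_smul' := fun c f => tendsto_nhds_unique (hL (c • f))
        (((hL f).const_smul c).congr fun n => (map_smul (φ n) c f).symm) }
    fun f hf => ge_of_tendsto' (hL f) fun n => hpos n f hf, fun f l hl => ?_⟩
  exact tendsto_nhds_unique (hL f) (hl.mono_left (Nat.hyperfilter_le_atTop))

/-- Orthogonality of the characters on the `n`-th roots of unity. -/
theorem sum_star_pow_mul_pow_eq {n : ℕ} {ζ : ℂ} (hζ : IsPrimitiveRoot ζ n) (hn : star ζ * ζ = 1)
    {a c : ℕ} (ha : a < n) (hc : c < n) :
    ∑ u ∈ range n, star (ζ ^ u) ^ a * (ζ ^ u) ^ c = if a = c then (n : ℂ) else 0 := by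
  have h : ∀ u, star (ζ ^ u) ^ a * (ζ ^ u) ^ c = (star ζ ^ a * ζ ^ c) ^ u := fun u => by
    rw [star_pow, mul_pow, ← pow_mul, ← pow_mul, ← pow_mul, ← pow_mul, mul_comm u a, mul_comm u c]
  simp only [h]
  split_ifs with hac
  · subst hac
    simp only [← mul_pow, hn, one_pow, sum_const, card_range, nsmul_eq_mul, mul_one]
  · have hne : star ζ ^ a * ζ ^ c ≠ 1 := fun h1 => by
      refine hac (hζ.pow_inj ha hc ?_)
      calc ζ ^ a = ζ ^ a * (star ζ ^ a * ζ ^ c) := by rw [h1, mul_one]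
        _ = (star ζ * ζ) ^ a * ζ ^ c := by ring
        _ = ζ ^ c := by rw [hn, one_pow, one_mul]
    have hp : (star ζ ^ a * ζ ^ c) ^ n = 1 := by
      rw [mul_pow, ← pow_mul, ← pow_mul, mul_comm a, mul_comm c, pow_mul, pow_mul, ← star_pow,
        hζ.pow_eq_one]
      simp
    rw [geom_sum_eq hne, hp, sub_self, zero_div]

/-- The parameter space of the unit sphere of `ℂ²`, where `(s, z, w)` stands for the point
`(√s z, √(1 - s) w)`. -/
abbrev SphereParam : Type := unitInterval × Circle × Circle

/-- The first coordinate `√s z` on the sphere. -/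
def sphereCoord₁ : C(SphereParam, ℂ) :=
  ⟨fun x => (√(x.1 : ℝ) : ℂ) * x.2.1, by fun_prop⟩

/-- The second coordinate `√(1 - s) w` on the sphere. -/
def sphereCoord₂ : C(SphereParam, ℂ) :=
  ⟨fun x => (√(1 - x.1 : ℝ) : ℂ) * x.2.2, by fun_prop⟩

/-- The monomial with exponents `k` in the two coordinates on the sphere. -/
def sphereMonomial (k : ℕ × ℕ) : C(SphereParam, ℂ) :=
  sphereCoord₁ ^ k.1 * sphereCoord₂ ^ k.2

/-- The grid point with `s = i / n`, whose phases are powers of the primitive `n`-th root of unity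
with exponents `u`. The projection to the unit interval acts as the identity for `i ≤ n`. -/
def gridPoint (n i : ℕ) (u : ℕ × ℕ) : SphereParam :=
  (Set.projIcc 0 1 zero_le_one (i / n : ℝ), Circle.exp (2 * Real.pi / n) ^ u.1,
    Circle.exp (2 * Real.pi / n) ^ u.2)

/-- The positive functional which integrates over `s` with the Bernstein weights of `γ` and averages
over pairs of `n`-th roots of unity. -/
def sphereSum (γ : ℕ × ℕ → ℝ) (n : ℕ) : C(SphereParam, ℂ) →ₗ[ℂ] ℂ :=
  ∑ x ∈ HasAntidiagonal.antidiagonal n, ∑ u ∈ range n ×ˢ range n,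
    ((n.choose x.1 * γ x / (n : ℝ) ^ 2 : ℝ) : ℂ) •
      (ContinuousMap.evalCLM ℂ (gridPoint n x.1 u)).toLinearMap

theorem sphereSum_apply (γ : ℕ × ℕ → ℝ) (n : ℕ) (f : C(SphereParam, ℂ)) :
    sphereSum γ n f = ∑ x ∈ HasAntidiagonal.antidiagonal n, ∑ u ∈ range n ×ˢ range n,
      ((n.choose x.1 * γ x / (n : ℝ) ^ 2 : ℝ) : ℂ) * f (gridPoint n x.1 u) := by
  simp only [sphereSum, LinearMap.sum_apply, LinearMap.smul_apply, smul_eq_mul]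
  rfl

theorem sphereSum_nonneg {γ : ℕ × ℕ → ℝ} (hγ : ∀ k, 0 ≤ γ k) (n : ℕ) {f : C(SphereParam, ℂ)}
    (hf : 0 ≤ f) : 0 ≤ sphereSum γ n f := by
  rw [sphereSum_apply]
  refine sum_nonneg fun x _ => sum_nonneg fun u _ => mul_nonneg ?_ (hf _)
  have := hγ x
  exact Complex.zero_le_real.2 (by positivity)

theorem norm_sphereSum_le {γ : ℕ × ℕ → ℝ} (hγ0 : ∀ k, 0 ≤ γ k)
    (hγ : ∀ i j, γ (i, j) = γ (i + 1, j) + γ (i, j + 1)) (n : ℕ) (f : C(SphereParam, ℂ)) :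
    ‖sphereSum γ n f‖ ≤ γ (0, 0) * ‖f‖ := by
  rcases n.eq_zero_or_pos with rfl | hn
  · have := hγ0 (0, 0)
    simp [sphereSum_apply]
    positivity
  rw [sphereSum_apply, ← sum_choose_mul_eq hγ n, sum_mul]
  refine (norm_sum_le _ _).trans (sum_le_sum fun x _ => (norm_sum_le _ _).trans ?_)
  have hx : 0 ≤ n.choose x.1 * γ x / (n : ℝ) ^ 2 := by have := hγ0 x; positivity
  calc ∑ u ∈ range n ×ˢ range n,
        ‖((n.choose x.1 * γ x / (n : ℝ) ^ 2 : ℝ) : ℂ) * f (gridPoint n x.1 u)‖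
      ≤ ∑ u ∈ range n ×ˢ range n, n.choose x.1 * γ x / (n : ℝ) ^ 2 * ‖f‖ := by
        refine sum_le_sum fun u _ => ?_
        rw [norm_mul, Complex.norm_real, Real.norm_of_nonneg hx]
        exact mul_le_mul_of_nonneg_left (f.norm_coe_le_norm _) hx
    _ = n.choose x.1 * γ x * ‖f‖ := by
        rw [sum_const, card_product, card_range, nsmul_eq_mul]
        push_cast
        field_simp

theorem star_sphereMonomial_mul_apply_gridPoint {n : ℕ} (hn : 0 < n) {x : ℕ × ℕ}
    (hx : x ∈ HasAntidiagonal.antidiagonal n) (k l u : ℕ × ℕ) :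
    (star (sphereMonomial k) * sphereMonomial l) (gridPoint n x.1 u) =
      ((√(x.1 / n : ℝ) ^ (k.1 + l.1) * √(x.2 / n : ℝ) ^ (k.2 + l.2) : ℝ) : ℂ) *
      ((star ((Circle.exp (2 * Real.pi / n) : ℂ) ^ u.1) ^ k.1 *
          ((Circle.exp (2 * Real.pi / n) : ℂ) ^ u.1) ^ l.1) *
        (star ((Circle.exp (2 * Real.pi / n) : ℂ) ^ u.2) ^ k.2 *
          ((Circle.exp (2 * Real.pi / n) : ℂ) ^ u.2) ^ l.2)) := by
  rw [HasAntidiagonal.mem_antidiagonal] at hx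
  have hn' : (0 : ℝ) < n := by exact_mod_cast hn
  have hsum : (x.1 : ℝ) + x.2 = n := by exact_mod_cast hx
  have hmem : (x.1 / n : ℝ) ∈ Set.Icc (0 : ℝ) 1 :=
    ⟨by positivity, (div_le_one hn').2 (by linarith [x.2.cast_nonneg (α := ℝ)])⟩
  have hs : ((gridPoint n x.1 u).1 : ℝ) = x.1 / n := by
    simp only [gridPoint, Set.projIcc_of_mem zero_le_one hmem]
  have ht : 1 - ((gridPoint n x.1 u).1 : ℝ) = x.2 / n := by
    rw [hs]; field_simp; linarith
  have h₁ : sphereCoord₁ (gridPoint n x.1 u) =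
      (√(x.1 / n : ℝ) : ℂ) * (Circle.exp (2 * Real.pi / n) : ℂ) ^ u.1 := by
    rw [← hs]; rfl
  have h₂ : sphereCoord₂ (gridPoint n x.1 u) =
      (√(x.2 / n : ℝ) : ℂ) * (Circle.exp (2 * Real.pi / n) : ℂ) ^ u.2 := by
    rw [← ht]; rfl
  have hconj : ∀ r : ℝ, star (r : ℂ) = r := fun r => Complex.conj_ofReal r
  simp only [sphereMonomial, ContinuousMap.mul_apply, ContinuousMap.star_apply,
    ContinuousMap.pow_apply, h₁, h₂, star_mul', star_pow, hconj]
  push_cast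
  ring

theorem sphereSum_star_monomial_mul {γ : ℕ × ℕ → ℝ} {n : ℕ} {k l : ℕ × ℕ}
    (hk : k.1 < n ∧ k.2 < n) (hl : l.1 < n ∧ l.2 < n) :
    sphereSum γ n (star (sphereMonomial k) * sphereMonomial l) =
      if k = l then (bernsteinMoment γ 0 0 0 k.1 k.2 n : ℂ) else 0 := by
  have hn : 0 < n := by omega
  have hn' : (n : ℂ) ≠ 0 := by exact_mod_cast hn.ne'
  have hζ : IsPrimitiveRoot (Circle.exp (2 * Real.pi / n) : ℂ) n := by
    have := Complex.isPrimitiveRoot_exp n hn.ne'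
    rw [Circle.coe_exp]
    convert this using 2
    push_cast
    ring
  have hζ1 : star (Circle.exp (2 * Real.pi / n) : ℂ) * (Circle.exp (2 * Real.pi / n) : ℂ) = 1 := by
    have := Complex.normSq_eq_conj_mul_self (z := (Circle.exp (2 * Real.pi / n) : ℂ))
    rw [Circle.normSq_coe] at this
    exact_mod_cast this.symm
  have hsum : ∀ x ∈ HasAntidiagonal.antidiagonal n, ∑ u ∈ range n ×ˢ range n,
      ((n.choose x.1 * γ x / (n : ℝ) ^ 2 : ℝ) : ℂ) *
        (star (sphereMonomial k) * sphereMonomial l) (gridPoint n x.1 u) =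
      if k = l then ((n.choose x.1 * γ x *
        ((x.1 / n : ℝ) ^ k.1 * (x.2 / n : ℝ) ^ k.2) : ℝ) : ℂ) else 0 := fun x hx => by
    simp only [star_sphereMonomial_mul_apply_gridPoint hn hx k l]
    rw [← mul_sum, ← mul_sum, sum_product]
    dsimp only
    rw [← sum_mul_sum,
      sum_star_pow_mul_pow_eq hζ hζ1 hk.1 hl.1, sum_star_pow_mul_pow_eq hζ hζ1 hk.2 hl.2]
    by_cases hkl : k = l
    · subst hkl
      rw [if_pos rfl, if_pos rfl, if_pos rfl, ← two_mul, ← two_mul, pow_mul, pow_mul,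
        Real.sq_sqrt (by positivity), Real.sq_sqrt (by positivity)]
      push_cast
      field_simp
    · rw [if_neg hkl]
      by_cases h1 : k.1 = l.1
      · rw [if_neg fun h2 => hkl (Prod.ext h1 h2)]; simp
      · rw [if_neg h1]; simp
  rw [sphereSum_apply, sum_congr rfl hsum]
  by_cases hkl : k = l
  · simp [hkl, bernsteinMoment]
  · simp [hkl]

/-- The limit functional: the monomials are orthogonal, with squared norms `γ k`. -/
theorem exists_positive_functional_moments {γ : ℕ × ℕ → ℝ} (hγ0 : ∀ k, 0 ≤ γ k)
    (hγ : ∀ i j, γ (i, j) = γ (i + 1, j) + γ (i, j + 1)) :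
    ∃ Λ : C(SphereParam, ℂ) →ₚ[ℂ] ℂ, ∀ k l,
      Λ (star (sphereMonomial k) * sphereMonomial l) = if k = l then (γ k : ℂ) else 0 := by
  obtain ⟨Λ, hΛ⟩ := exists_positiveLinearMap_of_tendsto (sphereSum γ)
    (fun n f hf => sphereSum_nonneg hγ0 n hf) (γ (0, 0)) (norm_sphereSum_le hγ0 hγ)
  refine ⟨Λ, fun k l => hΛ _ _ ?_⟩
  have hev : ∀ᶠ n in atTop, (if k = l then (bernsteinMoment γ 0 0 0 k.1 k.2 n : ℂ) else 0) =
      sphereSum γ n (star (sphereMonomial k) * sphereMonomial l) := by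
    filter_upwards [eventually_gt_atTop (k.1 + k.2 + l.1 + l.2)] with n hn
    exact (sphereSum_star_monomial_mul (by omega) (by omega)).symm
  refine Tendsto.congr' hev ?_
  split_ifs
  · exact (Complex.continuous_ofReal.tendsto _).comp (tendsto_bernsteinMoment hγ 0 0 0 k.1 k.2)
  · exact tendsto_const_nhds

/-- A commuting pair of normal operators which moves an orthogonal family with squared norms `γ`
along the lattice: multiplication by the coordinates, in the Gelfand–Naimark–Segal representation
of the limit functional. -/
theorem exists_commuting_normal_pair_inner_eq {γ : ℕ × ℕ → ℝ} (hγ0 : ∀ k, 0 ≤ γ k)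
    (hγ : ∀ i j, γ (i, j) = γ (i + 1, j) + γ (i, j + 1)) :
    ∃ (K : Type) (_ : NormedAddCommGroup K) (_ : InnerProductSpace ℂ K) (_ : CompleteSpace K)
      (N₁ N₂ : K →L[ℂ] K) (v : ℕ × ℕ → K), IsStarNormal N₁ ∧ IsStarNormal N₂ ∧ Commute N₁ N₂ ∧
      (∀ k, N₁ (v k) = v (k + (1, 0)) ∧ N₂ (v k) = v (k + (0, 1))) ∧
      ∀ k l, ⟪v k, v l⟫_ℂ = if k = l then (γ k : ℂ) else 0 := by
  obtain ⟨Λ, hΛ⟩ := exists_positive_functional_moments hγ0 hγ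
  have hN : ∀ f, IsStarNormal (Λ.gnsStarAlgHom f) := fun f =>
    (isStarNormal_iff _).2 (by
      rw [← map_star]; exact (Commute.all (star f) f).map Λ.gnsStarAlgHom)
  refine ⟨Λ.GNS, inferInstance, inferInstance, inferInstance, Λ.gnsStarAlgHom sphereCoord₁,
    Λ.gnsStarAlgHom sphereCoord₂, fun k => (Λ.toPreGNS (sphereMonomial k) : Λ.GNS),
    hN _, hN _, (Commute.all _ _).map Λ.gnsStarAlgHom, fun k => ⟨?_, ?_⟩, fun k l => ?_⟩
  · have : sphereMonomial (k + (1, 0)) = sphereCoord₁ * sphereMonomial k := by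
      simp only [sphereMonomial, Prod.fst_add, Prod.snd_add, add_zero]; ring
    dsimp only
    rw [this]
    exact Λ.gnsNonUnitalStarAlgHom_apply_coe
  · have : sphereMonomial (k + (0, 1)) = sphereCoord₂ * sphereMonomial k := by
      simp only [sphereMonomial, Prod.fst_add, Prod.snd_add, add_zero]; ring
    dsimp only
    rw [this]
    exact Λ.gnsNonUnitalStarAlgHom_apply_coe
  · rw [UniformSpace.Completion.inner_coe, Λ.preGNS_inner_def]
    exact hΛ k l

/-! ### The normal extension -/

/-- The product of the weights along the lattice path from the origin to `k` which runs first along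
the horizontal axis and then upwards. -/
def pathProd (α β : Weights) (k : ℕ × ℕ) : ℝ :=
  (∏ i ∈ Finset.range k.1, α (i, 0)) * ∏ j ∈ Finset.range k.2, β (k.1, j)

theorem pathProd_pos {α β : Weights} (hα : ∀ k, 0 < α k) (hβ : ∀ k, 0 < β k) (k : ℕ × ℕ) :
    0 < pathProd α β k :=
  mul_pos (Finset.prod_pos fun _ _ => hα _) (Finset.prod_pos fun _ _ => hβ _)

theorem pathProd_up (α β : Weights) (a b : ℕ) :
    pathProd α β (a, b + 1) = β (a, b) * pathProd α β (a, b) := by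
  simp only [pathProd, Finset.prod_range_succ]; ring

/-- For commuting shifts the path product does not depend on the path. -/
theorem pathProd_right {α β : Weights} (h : Commute (shift₁ α) (shift₂ β)) (a b : ℕ) :
    pathProd α β (a + 1, b) = α (a, b) * pathProd α β (a, b) := by
  induction b with
  | zero => simp only [pathProd, Finset.prod_range_succ, Finset.range_zero, Finset.prod_empty]; ring
  | succ b ih =>
    have := weights_commute h (a, b)
    simp only [Prod.mk_add_mk, add_zero] at this
    rw [pathProd_up, pathProd_up, ih]
    linear_combination -pathProd α β (a, b) * this

theorem isSubnormalPair_of_const {α β : Weights} (hα : ∀ k, 0 < α k) (hβ : ∀ k, 0 < β k)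
    (hcomm : Commute (shift₁ α) (shift₂ β)) {c : ℝ} (hc : ∀ k, α k ^ 2 + β k ^ 2 = c) :
    IsSubnormalPair (shift₁ α) (shift₂ β) := by
  have hc0 : 0 < c := by have := hα 0; rw [← hc 0]; positivity
  set s := √c with hs
  have hs0 : 0 < s := Real.sqrt_pos.2 hc0
  have hs2 : s ^ 2 = c := Real.sq_sqrt hc0.le
  set g : ℕ × ℕ → ℝ := fun k => pathProd α β k / s ^ (k.1 + k.2) with hg
  have hg0 : ∀ k, 0 < g k := fun k => div_pos (pathProd_pos hα hβ k) (by positivity)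
  have hgr : ∀ k, s * g (k + (1, 0)) = α k * g k := fun ⟨a, b⟩ => by
    simp only [hg, Prod.mk_add_mk, add_zero, pathProd_right hcomm]
    rw [show a + 1 + b = a + b + 1 by ring, pow_succ]
    field_simp
  have hgu : ∀ k, s * g (k + (0, 1)) = β k * g k := fun ⟨a, b⟩ => by
    simp only [hg, Prod.mk_add_mk, add_zero, pathProd_up]
    rw [← add_assoc, pow_succ]
    field_simp
  obtain ⟨K, _, _, _, N₁, N₂, v, hN₁, hN₂, hN, hv, hin⟩ :=
    exists_commuting_normal_pair_inner_eq (γ := fun k => g k ^ 2) (fun k => sq_nonneg _)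
      (fun i j => by
        have h1 := hgr (i, j)
        have h2 := hgu (i, j)
        simp only [Prod.mk_add_mk, add_zero] at h1 h2
        have : s ^ 2 * g (i, j) ^ 2 = s ^ 2 * (g (i + 1, j) ^ 2 + g (i, j + 1) ^ 2) := by
          rw [mul_add, ← mul_pow, ← mul_pow, ← mul_pow, h1, h2, mul_pow, mul_pow, mul_pow, hs2,
            ← hc (i, j)]
          ring
        exact mul_left_cancel₀ (by positivity) this)
  have hgC : ∀ k, (g k : ℂ) ≠ 0 := fun k => by exact_mod_cast (hg0 k).ne'
  have hon : Orthonormal ℂ fun k => (g k : ℂ)⁻¹ • v k := by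
    rw [orthonormal_iff_ite]
    intro k l
    rw [inner_smul_left, inner_smul_right, hin]
    split_ifs with hkl
    · subst hkl
      have := hgC k
      rw [map_inv₀, Complex.conj_ofReal]
      push_cast
      field_simp
    · simp
  -- `J` sends the basis vector `e k` to the normalized monomial, so it intertwines the operators.
  set J := hon.orthogonalFamily.linearIsometry with hJ
  have hJe : ∀ k, J (e k) = (g k : ℂ)⁻¹ • v k := fun k => by
    rw [hJ, e, hon.orthogonalFamily.linearIsometry_apply_single]
    simp
  have inter : ∀ (N : K →L[ℂ] K) (ε : ℕ × ℕ) (w : Weights), (∀ k, N (v k) = v (k + ε)) →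
      (∀ k, s * g (k + ε) = w k * g k) → ∀ x, ((s : ℂ) • N) (J x) = J (shift ε w x) := by
    intro N ε w hNv hw x
    have : ((s : ℂ) • N) ∘L J.toContinuousLinearMap = J.toContinuousLinearMap ∘L shift ε w :=
      ext_e fun k => by
        change (s : ℂ) • N (J (e k)) = J (shift ε w (e k))
        rw [shift_apply_e, map_smul, hJe, hJe, map_smul, hNv, smul_smul, smul_smul]
        congr 1
        have h1 := hgC k
        have h2 := hgC (k + ε)
        have h3 : (s : ℂ) * g (k + ε) = w k * g k := by exact_mod_cast hw k
        field_simp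
        linear_combination h3
    exact congrArg (fun A : L2 →L[ℂ] K => A x) this
  have hsm : ∀ N : K →L[ℂ] K, IsStarNormal N → IsStarNormal ((s : ℂ) • N) := fun N hN =>
    (isStarNormal_iff _).2 (by
      rw [star_smul]; exact (hN.star_comm_self.smul_left _).smul_right _)
  exact ⟨K, inferInstance, inferInstance, inferInstance, J, (s : ℂ) • N₁, (s : ℂ) • N₂, hsm _ hN₁,
    hsm _ hN₂, (hN.smul_left _).smul_right _, fun x =>
      ⟨inter N₁ _ α (fun k => (hv k).1) hgr x, inter N₂ _ β (fun k => (hv k).2) hgu x⟩⟩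

end SphericalAluthge

end

open SphericalAluthge in
theorem lemma10p4 (α β : Weights) (hα : ∀ k, 0 < α k) (hβ : ∀ k, 0 < β k) :
    (IsSphericallyQuasinormal (shift₁ α) (shift₂ β) ↔
      ∃ C : ℝ, 0 < C ∧
        IsSphericalIsometry (((1 / C : ℝ) : ℂ) • shift₁ α) (((1 / C : ℝ) : ℂ) • shift₂ β)) ∧
    (IsSphericallyQuasinormal (shift₁ α) (shift₂ β) ↔
      Commute (shift₁ α) (shift₂ β) ∧ ∃ c : ℝ, ∀ k, α k ^ 2 + β k ^ 2 = c) ∧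
    (IsSphericallyQuasinormal (shift₁ α) (shift₂ β) →
      IsSubnormalPair (shift₁ α) (shift₂ β)) := by
  have hconst := weights_sq_add_const_of_isSphericallyQuasinormal hα hβ
  refine ⟨⟨fun h => ?_, ?_⟩, ⟨fun h => ⟨h.1, _, hconst h⟩, ?_⟩, fun h => ?_⟩
  · have h0 : 0 < α 0 ^ 2 + β 0 ^ 2 := by have := hα 0; positivity
    refine ⟨√(α 0 ^ 2 + β 0 ^ 2), Real.sqrt_pos.2 h0,
      (isSphericalIsometry_smul_iff α β (Real.sqrt_pos.2 h0)).2 ⟨h.1, fun k => ?_⟩⟩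
    rw [Real.sq_sqrt h0.le]
    exact hconst h k
  · rintro ⟨C, hC, h⟩
    obtain ⟨hcomm, hk⟩ := (isSphericalIsometry_smul_iff α β hC).1 h
    exact isSphericallyQuasinormal_of_const hα hcomm hk
  · rintro ⟨hcomm, c, hc⟩
    exact isSphericallyQuasinormal_of_const hα hcomm hc
  · exact isSubnormalPair_of_const hα hβ h.1 (hconst h)
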